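/- Let $M_N$ be the algebra of complex $N\times N$ matrices and let $P$ be its pure state space with the weak$^*$ topology. For a density matrix $\rho$ (positive, trace one) let $\omega_\rho(x)=\mathrm{tr}(\rho x)$; in particular $\omega_{|e\rangle\langle e|}\in P$ for every unit vector $e$. An orthogonal measure representing $\omega_\rho$ is a measure $\sum_{i=1}^N b_i\delta_{\omega_{|f_i\rangle\langle f_i|}}$ on $P$, where $\rho=\sum_{i=1}^N b_i|f_i\rangle\langle f_i|$ is a diagonal form of $\rho$ in an orthonormal basis $(f_i)$ ($b_i$ may be zero). A net $(\mu_t)_{t\ge 0}$ of Borel probability measures on $P$ satisfies a large deviation principle (LDP) with powers $(1/t)$ and rate function $J$ if $J:P\to[0,+\infty]$ is lower semicontinuous, $\limsup_{t\to\infty}\mu_t(F)^{1/t}\le\sup_{F}e^{-J}$ for all closed $F\subset P$, and $\sup_{G}e^{-J}\le\liminf_{t\to\infty}\mu_t(G)^{1/t}$ for all open $G\subset P$. Limits of $\frac1t\log(\cdot)$ are taken as $t\to\infty$ in $[-\infty,+\infty]$, with $\log 0=-\infty$. Let $(\rho_t)_{t\ge 0}$ and $\rho_\infty$ be density matrices in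 $M_N$ such that $\omega_{\rho_t}\to\omega_{\rho_\infty}$ in the weak$^*$ topology as $t\to\infty$. Let $a_{1,t}\ge\dots\ge a_{N,t}$ be the eigenvalues of $\rho_t$, and $a_1\ge\dots\ge a_N$ those of $\rho_\infty$, counted with multiplicity, with $a_i\ne 0$ exactly for $i\le r$. For orthonormal bases $(e_{i,t})_{i}$ ($t\ge0$) and $(e_i)_i$ of $\mathbb{C}^N$, consider for $1\le i\le N$ the property $(P_i)$: for all $t$ large enough $e_{i,t}$ is an eigenvector of $\rho_t$ for $a_{i,t}$, $e_i$ is an eigenvector of $\rho_\infty$ for $a_i$, and $\lim_t\omega_{|e_{i,t}\rangle\langle e_{i,t}|}=\omega_{|e_i\rangle\langle e_i|}$. If $\lim_t\frac1t\log a_{i,t}$ exists for all $i\in\{r+1,\dots,N\}$, put $$J(\omega)=\begin{cases}0&\text{if }\omega=\omega_{|e_i\rangle\langle e_i|},\ 1\le i\le r,\\ -\lim_t\frac1t\log a_{i,t}&\text{if }\omega=\omega_{|e_i\rangle\langle e_i|},\ r+1\le i\le N,\\ +\infty&\text{for all other }\omega\in P.\end{cases}\qquad(*)$$ (a) Suppose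 that $(P_i)$ holds for all $i\in\{1,\dots,N\}$, and let $\mu_t=\sum_{i=1}^N a_{i,t}\delta_{\omega_{|e_{i,t}\rangle\langle e_{i,t}|}}$. Then $(\mu_t)$ satisfies an LDP with powers $(1/t)$ if and only if $\lim_t\frac1t\log a_{i,t}$ exists for all $i\in\{r+1,\dots,N\}$. In this case the rate function is $J$ given by $(*)$, and it is the only one. Moreover, in this case, for each $i\in\{1,\dots,N\}$ and each open $G\subset P$ with $\omega_{|e_i\rangle\langle e_i|}\in G$ and $\overline G\cap\{\omega_{|e_j\rangle\langle e_j|}:j\ne i\}=\emptyset$, the limits $\lim_t\frac1t\log\mu_t(G)$ and $\lim_t\frac1t\log a_{i,t}$ exist and are equal. (b) Conversely, let $\rho_\infty=\sum_{i=1}^N a_i|e_i\rangle\langle e_i|$ be a diagonal form in an orthonormal basis $(e_i)$, suppose that $\lim_t\frac1t\log a_{i,t}$ exists for all $i\in\{r+1,\dots,N\}$, and let each $\omega_{\rho_t}$ be represented by an orthogonal measure $\mu_t$ such that $(\mu_t)$ satisfies an LDP with powers $(1/t)$ and rate function $J$ given by $(*)$. Then, after a relabelling of the eigenvalues of $\rho_t$,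 $(P_i)$ holds for all $i$ with $J(\omega_{|e_i\rangle\langle e_i|})<+\infty$. Precisely: there are permutations $\sigma_t$ of $\{1,\dots,N\}$ and orthonormal bases $(e_{i,t})_i$ such that, for every such $i$, $(P_i)$ holds with $a_{\sigma_t(i),t}$ in place of $a_{i,t}$, and for all $t$ large enough $a_{\sigma_t(i)}=a_i$ and $J(\omega_{|e_{\sigma_t(i)}\rangle\langle e_{\sigma_t(i)}|})=J(\omega_{|e_i\rangle\langle e_i|})$ (so only indices with the same limits are exchanged, and no relabelling is needed when these pairs of limits are pairwise distinct). -/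

import Mathlib

open Filter Topology MeasureTheory Matrix
open scoped NNReal ENNReal ComplexOrder

noncomputable section

namespace OrthLDP

/-! ### Large deviation principles with powers `1/t` -/

/-- The net `(μ_t)_{t ≥ 0}` of Borel probability measures satisfies a large deviation principle
with powers `1/t` and (lower semicontinuous, `[0,∞]`-valued) rate function `J`. -/
structure LDP {X : Type*} [TopologicalSpace X] [MeasurableSpace X]
    (μ : ℝ≥0 → Measure X) (J : X → ℝ≥0∞) : Prop where
  lsc : LowerSemicontinuous J
  upper : ∀ F : Set X, IsClosed F →
    limsup (fun t : ℝ≥0 => (μ t F) ^ (1 / (t : ℝ))) atTop ≤ ⨆ x ∈ F, EReal.exp (-(J x : EReal))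
  lower : ∀ G : Set X, IsOpen G →
    ⨆ x ∈ G, EReal.exp (-(J x : EReal)) ≤ liminf (fun t : ℝ≥0 => (μ t G) ^ (1 / (t : ℝ))) atTop

/-- `(1/t) log m ∈ [-∞, ∞]`, with `log 0 = -∞`. Only used for large `t`. -/
def logRate (t : ℝ≥0) (m : ℝ≥0∞) : EReal := ((1 / (t : ℝ) : ℝ) : EReal) * ENNReal.log m

/-! ### States and pure states of `M_N` -/

/-- The functional `ω_ρ : x ↦ tr (ρ x)` on `M_N`. -/
def omega {N : ℕ} (ρ : Matrix (Fin N) (Fin N) ℂ) : WeakDual ℂ (Matrix (Fin N) (Fin N) ℂ) :=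
  StrongDual.toWeakDual
    { toFun := fun x => (ρ * x).trace
      map_add' := fun x y => by simp [mul_add]
      map_smul' := fun c x => by simp
      cont := (continuous_const.matrix_mul continuous_id).matrix_trace }

@[simp] theorem omega_apply {N : ℕ} (ρ x : Matrix (Fin N) (Fin N) ℂ) :
    omega ρ x = (ρ * x).trace := rfl

/-- The state space of `M_N`: positive unital linear functionals (with the weak-* topology). -/
def stateSpace (N : ℕ) : Set (WeakDual ℂ (Matrix (Fin N) (Fin N) ℂ)) :=
  {φ | (∀ x : Matrix (Fin N) (Fin N) ℂ, 0 ≤ φ (xᴴ * x)) ∧ φ 1 = 1}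

/-- The pure state space `P` of `M_N`: the extreme points of the state space. -/
def PureState (N : ℕ) : Type :=
  ↥(Set.extremePoints ℝ (stateSpace N))

/-- `P` carries the weak-* topology. -/
instance (N : ℕ) : TopologicalSpace (PureState N) :=
  inferInstanceAs (TopologicalSpace ↥(Set.extremePoints ℝ (stateSpace N)))

/-- `P` carries its Borel σ-algebra. -/
instance (N : ℕ) : MeasurableSpace (PureState N) := borel _

instance (N : ℕ) : BorelSpace (PureState N) := ⟨rfl⟩

/-- The rank-one operator `|e⟩⟨e|`. -/
def ketBra {N : ℕ} (e : EuclideanSpace ℂ (Fin N)) : Matrix (Fin N) (Fin N) ℂ :=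
  vecMulVec e.ofLp (star e.ofLp)

theorem dotProduct_of_norm_one {N : ℕ} {e : EuclideanSpace ℂ (Fin N)} (he : ‖e‖ = 1) :
    star e.ofLp ⬝ᵥ e.ofLp = 1 := by
  have h := inner_self_eq_norm_sq_to_K (𝕜 := ℂ) e
  rw [EuclideanSpace.inner_eq_star_dotProduct, he, dotProduct_comm] at h
  simpa using h

theorem ketBra_mul_mul_ketBra {N : ℕ} (e : EuclideanSpace ℂ (Fin N))
    (x : Matrix (Fin N) (Fin N) ℂ) :
    ketBra e * x * ketBra e = (ketBra e * x).trace • ketBra e := by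
  simp only [ketBra, vecMulVec_mul, trace_vecMulVec, vecMul_vecMulVec, vecMulVec_smul]
  rw [dotProduct_comm]

theorem ketBra_mul_self {N : ℕ} {e : EuclideanSpace ℂ (Fin N)} (he : ‖e‖ = 1) :
    ketBra e * ketBra e = ketBra e := by
  simp only [ketBra, vecMulVec_mul_vecMulVec, dotProduct_of_norm_one he, one_smul]

theorem ketBra_conjTranspose {N : ℕ} (e : EuclideanSpace ℂ (Fin N)) :
    (ketBra e)ᴴ = ketBra e := by
  simp [ketBra, conjTranspose_vecMulVec]

theorem omega_ketBra_mem_stateSpace {N : ℕ} {e : EuclideanSpace ℂ (Fin N)} (he : ‖e‖ = 1) :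
    omega (ketBra e) ∈ stateSpace N := by
  refine ⟨fun x => ?_, ?_⟩
  · have h : omega (ketBra e) (xᴴ * x) = star (x *ᵥ e.ofLp) ⬝ᵥ (x *ᵥ e.ofLp) := by
      simp only [omega_apply, ketBra, vecMulVec_mul, trace_vecMulVec]
      rw [dotProduct_comm, ← dotProduct_mulVec, ← mulVec_mulVec, dotProduct_mulVec,
        star_mulVec]
    rw [h]
    exact dotProduct_star_self_nonneg _
  · simp only [omega_apply, mul_one, ketBra, trace_vecMulVec]
    rw [dotProduct_comm, dotProduct_of_norm_one he]

theorem eq_zero_of_quadratic {z c : ℂ} (hc : 0 ≤ c)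
    (h : ∀ r : ℝ, 0 ≤ (r : ℂ) * z + (r : ℂ) ^ 2 * c) : z = 0 := by
  have hc' := (Complex.le_def.1 hc)
  simp only [Complex.zero_re, Complex.zero_im] at hc'
  have hre : ∀ r : ℝ, 0 ≤ r * z.re + r ^ 2 * c.re := fun r => by
    have := (Complex.le_def.1 (h r)).1
    simpa [← Complex.ofReal_pow] using this
  have him : z.im = 0 := by
    have := (Complex.le_def.1 (h 1)).2
    simp only [Complex.ofReal_one, one_mul, one_pow, Complex.add_im, Complex.zero_im] at this
    linarith [hc'.2]
  have hz : z.re = 0 := by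
    have hpos : 0 < c.re + 1 := by linarith [hc'.1]
    have h1 := hre (-z.re / (c.re + 1))
    have h2 : -z.re / (c.re + 1) * z.re + (-z.re / (c.re + 1)) ^ 2 * c.re
        = -(z.re / (c.re + 1)) ^ 2 := by
      field_simp
      ring
    rw [h2] at h1
    have h3 : z.re / (c.re + 1) = 0 := by nlinarith
    rcases div_eq_zero_iff.1 h3 with h | h
    · exact h
    · exact absurd h hpos.ne'
  exact Complex.ext hz him

/-- A positive functional vanishing at a projection `q` vanishes on `q y` and on `y q`. -/
theorem vanish_of_proj {N : ℕ} {φ : WeakDual ℂ (Matrix (Fin N) (Fin N) ℂ)}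
    (hφ : ∀ x : Matrix (Fin N) (Fin N) ℂ, 0 ≤ φ (xᴴ * x)) {q : Matrix (Fin N) (Fin N) ℂ}
    (hq : qᴴ = q) (hqq : q * q = q) (h0 : φ q = 0) (y : Matrix (Fin N) (Fin N) ℂ) :
    φ (q * y) = 0 ∧ φ (yᴴ * q) = 0 := by
  have key : ∀ s : ℂ, 0 ≤ s * φ (q * y) + star s * φ (yᴴ * q) + star s * s * φ (yᴴ * y) := by
    intro s
    have h := hφ (q + s • y)
    have e : (q + s • y)ᴴ * (q + s • y)
        = q + s • (q * y) + star s • (yᴴ * q) + (star s * s) • (yᴴ * y) := by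
      simp only [conjTranspose_add, conjTranspose_smul, hq, add_mul, mul_add, smul_mul_assoc,
        mul_smul_comm, hqq]
      module
    rw [e] at h
    simpa only [map_add, map_smul, h0, zero_add, smul_eq_mul] using h
  have h1 : φ (q * y) + φ (yᴴ * q) = 0 := by
    refine eq_zero_of_quadratic (hφ y) fun r => ?_
    have h := key r
    simp only [RCLike.star_def, Complex.conj_ofReal] at h
    convert h using 1
    ring
  have h2 : Complex.I * (φ (q * y) - φ (yᴴ * q)) = 0 := by
    refine eq_zero_of_quadratic (hφ y) fun r => ?_
    have h := key (r * Complex.I)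
    simp only [RCLike.star_def, map_mul, Complex.conj_ofReal, Complex.conj_I] at h
    convert h using 1
    linear_combination ((r : ℂ) ^ 2 * φ (yᴴ * y)) * Complex.I_sq
  have h3 : φ (q * y) - φ (yᴴ * q) = 0 := by simpa using h2
  constructor
  · linear_combination (h1 + h3) / 2
  · linear_combination (h1 - h3) / 2

theorem omega_ketBra_mem_extremePoints {N : ℕ} {e : EuclideanSpace ℂ (Fin N)} (he : ‖e‖ = 1) :
    omega (ketBra e) ∈ Set.extremePoints ℝ (stateSpace N) := by
  refine ⟨omega_ketBra_mem_stateSpace he, ?_⟩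
  rintro φ hφ ψ hψ ⟨a, b, ha, hb, hab, hs⟩
  set p := ketBra e with hp
  have hpp : p * p = p := ketBra_mul_self he
  have hpa : pᴴ = p := ketBra_conjTranspose e
  set q := 1 - p with hq
  have hqa : qᴴ = q := by simp [hq, hpa]
  have hqq : q * q = q := by simp [hq, mul_sub, sub_mul, hpp]
  have hω : omega p q = 0 := by simp [hq, mul_sub, hpp]
  have hφq : 0 ≤ φ q := by simpa [hqa, hqq] using hφ.1 q
  have hψq : 0 ≤ ψ q := by simpa [hqa, hqq] using hψ.1 q
  have hsum : (a : ℂ) * φ q + (b : ℂ) * ψ q = 0 := by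
    rw [← hω, ← hs]
    rfl
  have h0 : φ q = 0 := by
    have h1 : 0 ≤ (a : ℂ) * φ q := mul_nonneg (by exact_mod_cast ha.le) hφq
    have h2 : 0 ≤ (b : ℂ) * ψ q := mul_nonneg (by exact_mod_cast hb.le) hψq
    have h3 := (add_eq_zero_iff_of_nonneg h1 h2).1 hsum
    rcases mul_eq_zero.1 h3.1 with h | h
    · exact absurd (by exact_mod_cast h) ha.ne'
    · exact h
  have hφp : φ p = 1 := by
    have : φ p = φ 1 - φ q := by rw [← map_sub, hq, sub_sub_cancel]
    rw [this, h0, hφ.2, sub_zero]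
  refine DFunLike.ext _ _ fun x => ?_
  have e1 : x = p * x * p + q * x + (((p * x)ᴴ)ᴴ) * q := by
    rw [conjTranspose_conjTranspose]
    simp only [hq]
    noncomm_ring
  have e2 : φ x = φ (p * x * p) := by
    conv_lhs => rw [e1]
    rw [map_add, map_add, (vanish_of_proj hφ.1 hqa hqq h0 x).1,
      (vanish_of_proj hφ.1 hqa hqq h0 (p * x)ᴴ).2, add_zero, add_zero]
  rw [e2, hp, ketBra_mul_mul_ketBra, map_smul, ← hp, hφp]
  simp

/-- The pure state `ω_{|e⟩⟨e|}` given by a unit vector `e`. -/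
def pureState {N : ℕ} (e : EuclideanSpace ℂ (Fin N)) (he : ‖e‖ = 1) : PureState N :=
  ⟨omega (ketBra e), omega_ketBra_mem_extremePoints he⟩

/-- The pure state `ω_{|e_i⟩⟨e_i|}` for an orthonormal basis `(e_i)`. -/
def basisState {N : ℕ} (e : OrthonormalBasis (Fin N) ℂ (EuclideanSpace ℂ (Fin N))) (i : Fin N) :
    PureState N :=
  pureState (e i) (e.orthonormal.1 i)

/-! ### Eigenvalues, diagonal forms and orthogonal measures -/

/-- `a` lists the eigenvalues of `ρ`, counted with multiplicity, in nonincreasing order. -/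
def IsOrderedSpectrum {N : ℕ} (ρ : Matrix (Fin N) (Fin N) ℂ) (a : Fin N → ℝ) : Prop :=
  Antitone a ∧ ρ.charpoly.roots = Finset.univ.val.map fun i => (a i : ℂ)

/-- `ρ` is a density matrix: positive with trace one. -/
def IsDensity {N : ℕ} (ρ : Matrix (Fin N) (Fin N) ℂ) : Prop :=
  ρ.PosSemidef ∧ ρ.trace = 1

/-- The diagonal form `ρ = ∑ a_i |e_i⟩⟨e_i|` in an orthonormal basis (`a_i` can be zero). -/
def IsDiagonalForm {N : ℕ} (ρ : Matrix (Fin N) (Fin N) ℂ) (a : Fin N → ℝ)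
    (e : OrthonormalBasis (Fin N) ℂ (EuclideanSpace ℂ (Fin N))) : Prop :=
  ρ = ∑ i, (a i : ℂ) • ketBra (e i)

/-- The measure `∑ a_i δ_{ω_{|e_i⟩⟨e_i|}}` on the pure state space. -/
def orthMeasure {N : ℕ} (a : Fin N → ℝ)
    (e : OrthonormalBasis (Fin N) ℂ (EuclideanSpace ℂ (Fin N))) : Measure (PureState N) :=
  ∑ i, ENNReal.ofReal (a i) • Measure.dirac (basisState e i)

/-- `μ` is an orthogonal measure on the pure state space representing `ω_ρ`, i.e. the measure
`∑ b_i δ_{ω_{|f_i⟩⟨f_i|}}` of some diagonal form `ρ = ∑ b_i |f_i⟩⟨f_i|`. -/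
def IsOrthogonalMeasure {N : ℕ} (ρ : Matrix (Fin N) (Fin N) ℂ) (μ : Measure (PureState N)) :
    Prop :=
  ∃ (b : Fin N → ℝ) (f : OrthonormalBasis (Fin N) ℂ (EuclideanSpace ℂ (Fin N))),
    IsDiagonalForm ρ b f ∧ μ = orthMeasure b f

/-- The property `(P_i)` for chosen orthonormal bases `(e_{i,t})_i` and `(e_i)_i`: for `t` large
`e_{i,t}` is an eigenvector of `ρ_t` for `a_{i,t}`, the vector `e_i` is an eigenvector of `ρ_∞`
for `a_i`, and `ω_{|e_{i,t}⟩⟨e_{i,t}|} → ω_{|e_i⟩⟨e_i|}`. -/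
structure EigenvectorConv {N : ℕ} (ρ : ℝ≥0 → Matrix (Fin N) (Fin N) ℂ)
    (ρinf : Matrix (Fin N) (Fin N) ℂ) (a : ℝ≥0 → Fin N → ℝ) (ainf : Fin N → ℝ)
    (e : ℝ≥0 → OrthonormalBasis (Fin N) ℂ (EuclideanSpace ℂ (Fin N)))
    (einf : OrthonormalBasis (Fin N) ℂ (EuclideanSpace ℂ (Fin N))) (i : Fin N) : Prop where
  eigen : ∀ᶠ t in atTop, ρ t *ᵥ (e t i).ofLp = (a t i : ℂ) • (e t i).ofLp
  eigen_inf : ρinf *ᵥ (einf i).ofLp = (ainf i : ℂ) • (einf i).ofLp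
  tendsto : Tendsto (fun t => basisState (e t) i) atTop (𝓝 (basisState einf i))

open Classical in
/-- The rate function: `0` at `ω_{|e_i⟩⟨e_i|}` with `i` among the first `r` indices, `-c_i` at
`ω_{|e_i⟩⟨e_i|}` for the other indices (these are distinct points), and `+∞` elsewhere (the
infimum over no index is `∞`). Here `c_i ≤ 0` will be `lim (1/t) log a_{i,t}`. -/
def rateFn {N : ℕ} (e : OrthonormalBasis (Fin N) ℂ (EuclideanSpace ℂ (Fin N))) (r : ℕ)
    (c : Fin N → EReal) (ω : PureState N) : ℝ≥0∞ :=
  if ∃ i : Fin N, (i : ℕ) < r ∧ ω = basisState e i then 0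
  else ⨅ (i : Fin N) (_ : r ≤ (i : ℕ) ∧ ω = basisState e i), (-(c i)).toENNReal

end OrthLDP

end

set_option linter.unusedSectionVars false

noncomputable section

namespace OrthLDP

/-! ### Large deviations of finitely supported measures -/

section Abstract

/-! An orthogonal measure has at most N atoms, and N^(1/t) → 1, so μ_t(S)^(1/t) behaves like the
largest w^(1/t) among the weights w of the atoms in S. Everything is phrased through these roots
instead of logarithms (`tendsto_logRate_iff`).

For (a), let the atoms converge to points y_i. If the roots of the weights converge to L_i, the LDP
holds with e^(-J(y_i)) = L_i and J = ∞ elsewhere (`ldp_of_tendsto`). Conversely, isolating each y_i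
in a small open set turns an LDP into convergence of the roots, and forces J = ∞ off the y_i
(`LDP.tendsto_of_tendsto`, `LDP.eq_top_of_tendsto`). Ordered eigenvalues are continuous
(`tendsto_orderedSpectrum`), so for i < r the root tends to 1 automatically.

For (b), the rates are known and the positions are not. Near y_i the upper bound excludes heavier
atoms, and the lower bound cannot be met by lighter ones alone, so an atom of rate exactly L_i is
there (`LDP.eventually_exists_mem`). Disjoint neighbourhoods make the choice injective, hence a
permutation (`LDP.exists_relabelling`). Eigenvalues are then recovered as traces of ρ_t against the
converging projections. -/

theorem tendsto_one_div_atTop : Tendsto (fun t : ℝ≥0 => 1 / (t : ℝ)) atTop (𝓝 0) := by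
  simp only [one_div]
  exact tendsto_inv_atTop_zero.comp (NNReal.tendsto_coe_atTop.2 tendsto_id)

theorem tendsto_const_rpow_one_div {m : ℝ≥0∞} (h0 : m ≠ 0) (ht : m ≠ ∞) :
    Tendsto (fun t : ℝ≥0 => m ^ (1 / (t : ℝ))) atTop (𝓝 1) := by
  lift m to ℝ≥0 using ht
  have h0' : m ≠ 0 := by simpa using h0
  have h1 := (tendsto_const_nhds (x := m)).nnrpow tendsto_one_div_atTop (Or.inl h0')
  rw [NNReal.rpow_zero] at h1
  simp_rw [← ENNReal.coe_rpow_of_ne_zero h0']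
  exact ENNReal.tendsto_coe.2 h1

theorem eventually_one_div_pos : ∀ᶠ t : ℝ≥0 in atTop, 0 < 1 / (t : ℝ) := by
  filter_upwards [eventually_gt_atTop 0] with t ht
  positivity

theorem finset_sup_rpow {ι : Type*} (s : Finset ι) (w : ι → ℝ≥0∞) {p : ℝ} (hp : 0 < p) :
    (s.sup w) ^ p = s.sup fun i => w i ^ p := by
  classical
  induction s using Finset.induction_on with
  | empty => simp [hp]
  | insert i s _ ih =>
    rw [Finset.sup_insert, Finset.sup_insert, ← ih]
    exact (ENNReal.monotone_rpow_of_nonneg hp.le).map_sup _ _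

theorem limsup_sum_rpow_le {ι : Type*} (s : Finset ι) {w : ℝ≥0 → ι → ℝ≥0∞} {L : ι → ℝ≥0∞}
    (hw : ∀ i ∈ s, Tendsto (fun t => w t i ^ (1 / (t : ℝ))) atTop (𝓝 (L i))) :
    limsup (fun t => (∑ i ∈ s, w t i) ^ (1 / (t : ℝ))) atTop ≤ s.sup L := by
  -- The factor is `card + 1`, not `card`: for empty `s` the base would be 0, whose roots do not
  -- tend to 1.
  have h1 : Tendsto (fun t : ℝ≥0 => ((s.card + 1 : ℕ) : ℝ≥0∞) ^ (1 / (t : ℝ)) *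
      s.sup fun i => w t i ^ (1 / (t : ℝ))) atTop (𝓝 (1 * s.sup L)) := by
    refine ENNReal.Tendsto.mul
      (tendsto_const_rpow_one_div (by simp) (ENNReal.natCast_ne_top _)) (Or.inl one_ne_zero)
      (Tendsto.finset_sup_nhds_apply hw) (Or.inr ENNReal.one_ne_top)
  rw [one_mul] at h1
  rw [← h1.limsup_eq]
  refine limsup_le_limsup ?_
  filter_upwards [eventually_one_div_pos] with t ht
  rw [← finset_sup_rpow s _ ht, ← ENNReal.mul_rpow_of_nonneg _ _ ht.le]
  refine ENNReal.rpow_le_rpow ?_ ht.le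
  calc ∑ i ∈ s, w t i ≤ s.card • s.sup (w t) :=
        Finset.sum_le_card_nsmul _ _ _ fun i hi => Finset.le_sup (f := w t) hi
    _ ≤ _ := by
        rw [nsmul_eq_mul]
        gcongr
        exact_mod_cast Nat.le_succ _

variable {X ι : Type*} [TopologicalSpace X] [MeasurableSpace X] [Fintype ι]

/-- The measure `∑ w_i δ_{x_i}`. -/
def atoms (w : ι → ℝ≥0∞) (x : ι → X) : Measure X := ∑ i, w i • Measure.dirac (x i)

open Classical in
theorem atoms_apply (w : ι → ℝ≥0∞) (x : ι → X) {S : Set X} (hS : MeasurableSet S) :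
    atoms w x S = ∑ i with x i ∈ S, w i := by
  simp [atoms, Measure.finsetSum_apply, Measure.dirac_apply' _ hS, Set.indicator_apply,
    Finset.sum_filter]

theorem le_atoms (w : ι → ℝ≥0∞) (x : ι → X) {S : Set X} (hS : MeasurableSet S) {i : ι}
    (hi : x i ∈ S) : w i ≤ atoms w x S := by
  classical
  rw [atoms_apply w x hS]
  exact Finset.single_le_sum (f := w) (fun _ _ => zero_le) (by simpa using hi)

theorem atoms_le [OpensMeasurableSpace X] (w : ι → ℝ≥0∞) (x : ι → X) {S : Set X}
    (hS : MeasurableSet S) {s : Finset ι} (hs : ∀ i, x i ∈ S → i ∈ s) :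
    atoms w x S ≤ ∑ i ∈ s, w i := by
  classical
  rw [atoms_apply w x hS]
  exact Finset.sum_le_sum_of_subset fun i hi => hs i (by simpa using hi)

/-- Only finitely many points can have a finite value; deleting those other than `x` leaves a
neighbourhood of `x` on which J is ∞ except at `x` itself. -/
theorem lowerSemicontinuous_of_eq_top [T1Space X] {J : X → ℝ≥0∞} {y : ι → X}
    (h : ∀ x, (∀ i, x ≠ y i) → J x = ⊤) : LowerSemicontinuous J := by
  intro x b hb
  have hcl : IsClosed (Set.range y \ {x}) := ((Set.finite_range y).subset Set.sdiff_subset).isClosed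
  filter_upwards [hcl.isOpen_compl.mem_nhds (by simp : x ∈ (Set.range y \ {x})ᶜ)] with z hz
  by_cases hzx : z = x
  · rwa [hzx]
  · have : ∀ i, z ≠ y i := fun i hi => hz ⟨⟨i, hi.symm⟩, hzx⟩
    rw [h z this]
    exact hb.trans_le le_top

/-- An open neighbourhood of `x` whose closure avoids a finite family of other points and lies
in a given neighbourhood of `x`. -/
theorem exists_open_separating [RegularSpace X] [T1Space X] (y : ι → X) (x : X) {U : Set X}
    (hU : U ∈ 𝓝 x) : ∃ G : Set X, IsOpen G ∧ x ∈ G ∧ closure G ⊆ U ∧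
      ∀ i, y i ≠ x → y i ∉ closure G := by
  have hcl : IsClosed (Set.range y \ {x}) := ((Set.finite_range y).subset Set.sdiff_subset).isClosed
  have hV := inter_mem hU (hcl.isOpen_compl.mem_nhds (by simp : x ∈ (Set.range y \ {x})ᶜ))
  obtain ⟨C, hC, hCcl, hCV⟩ := exists_mem_nhds_isClosed_subset hV
  obtain ⟨G, hGC, hG, hxG⟩ := mem_nhds_iff.1 hC
  have hcC : closure G ⊆ C := closure_minimal hGC hCcl
  exact ⟨G, hG, hxG, fun z hz => (hCV (hcC hz)).1,
    fun i hi hiG => (hCV (hcC hiG)).2 ⟨⟨i, rfl⟩, hi⟩⟩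

variable {w : ℝ≥0 → ι → ℝ≥0∞} {x : ℝ≥0 → ι → X} {y : ι → X} {L : ι → ℝ≥0∞} {J : X → ℝ≥0∞}

theorem exp_neg_eq_zero_iff {b : ℝ≥0∞} : EReal.exp (-(b : EReal)) = 0 ↔ b = ⊤ := by
  rw [EReal.exp_eq_zero_iff, EReal.neg_eq_bot_iff, EReal.coe_ennreal_eq_top_iff]

theorem exp_neg_injective : Function.Injective fun b : ℝ≥0∞ => EReal.exp (-(b : EReal)) :=
  fun _ _ h => EReal.coe_ennreal_injective
    (neg_injective (EReal.expOrderIso.injective h))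

theorem exp_neg_upperSemicontinuous (hJ : LowerSemicontinuous J) :
    UpperSemicontinuous fun z => EReal.exp (-(J z : EReal)) := by
  refine Continuous.comp_lowerSemicontinuous_antitone
    (g := fun b : ℝ≥0∞ => EReal.exp (-(b : EReal))) ?_ hJ fun a b hab => ?_
  · exact ENNReal.continuous_exp.comp (continuous_neg.comp continuous_coe_ennreal_ereal)
  · refine EReal.exp_monotone (EReal.neg_le_neg_iff.2 ?_)
    exact_mod_cast hab

/-- A closed F eventually misses every atom whose limit lies outside F, so only the atoms with limit
in F count. An open G eventually contains every atom whose limit it contains, and one such atom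
bounds the mass below. -/
theorem ldp_of_tendsto [T1Space X] [OpensMeasurableSpace X]
    (hx : ∀ i, Tendsto (fun t => x t i) atTop (𝓝 (y i)))
    (hw : ∀ i, Tendsto (fun t => w t i ^ (1 / (t : ℝ))) atTop (𝓝 (L i)))
    (hJ : ∀ i, EReal.exp (-(J (y i) : EReal)) = L i) (hJ' : ∀ z, (∀ i, z ≠ y i) → J z = ⊤) :
    LDP (fun t => atoms (w t) (x t)) J where
  lsc := lowerSemicontinuous_of_eq_top hJ'
  upper F hF := by
    classical
    have h1 : ∀ᶠ t in atTop, ∀ i, y i ∉ F → x t i ∉ F := by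
      rw [eventually_all]
      intro i
      by_cases hi : y i ∈ F
      · simp [hi]
      · filter_upwards [(hx i).eventually (hF.isOpen_compl.mem_nhds hi)] with t ht _ using ht
    calc limsup (fun t => (atoms (w t) (x t) F) ^ (1 / (t : ℝ))) atTop
        ≤ limsup (fun t => (∑ i with y i ∈ F, w t i) ^ (1 / (t : ℝ))) atTop := by
          refine limsup_le_limsup ?_
          filter_upwards [h1, eventually_one_div_pos] with t ht ht0
          refine ENNReal.rpow_le_rpow (atoms_le _ _ hF.measurableSet fun i hi => ?_) ht0.le
          by_contra hc
          exact ht i (by simpa using hc) hi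
      _ ≤ _ := limsup_sum_rpow_le _ fun i _ => hw i
      _ ≤ _ := by
          refine Finset.sup_le fun i hi => ?_
          rw [← hJ i]
          exact le_iSup₂_of_le (y i) (by simpa using hi) le_rfl
  lower G hG := by
    refine iSup₂_le fun z hz => ?_
    by_cases hzy : ∃ i, z = y i
    · obtain ⟨i, rfl⟩ := hzy
      rw [hJ i, ← (hw i).liminf_eq]
      refine liminf_le_liminf ?_
      filter_upwards [(hx i).eventually (hG.mem_nhds hz), eventually_one_div_pos] with t ht ht0
      exact ENNReal.rpow_le_rpow (le_atoms _ _ hG.measurableSet ht) ht0.le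
    · push Not at hzy
      rw [exp_neg_eq_zero_iff.2 (hJ' z hzy)]
      exact zero_le

theorem LDP.eq_top_of_tendsto [RegularSpace X] [T1Space X] [OpensMeasurableSpace X]
    (h : LDP (fun t => atoms (w t) (x t)) J)
    (hx : ∀ i, Tendsto (fun t => x t i) atTop (𝓝 (y i))) {z : X} (hz : ∀ i, z ≠ y i) :
    J z = ⊤ := by
  obtain ⟨G, hG, hzG, -, hGy⟩ := exists_open_separating y z univ_mem
  rw [← exp_neg_eq_zero_iff, ← nonpos_iff_eq_zero]
  refine (le_iSup₂_of_le z hzG le_rfl).trans ((h.lower G hG).trans ?_)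
  have h0 : (fun t : ℝ≥0 => (atoms (w t) (x t) G) ^ (1 / (t : ℝ))) =ᶠ[atTop] fun _ => 0 := by
    have h1 : ∀ᶠ t in atTop, ∀ i, x t i ∉ G := by
      rw [eventually_all]
      intro i
      filter_upwards [(hx i).eventually
        (isClosed_closure.isOpen_compl.mem_nhds (hGy i (hz i).symm))] with t ht hc
      exact ht (subset_closure hc)
    filter_upwards [h1, eventually_one_div_pos] with t ht ht0
    rw [atoms_apply _ _ hG.measurableSet]
    simp only [ht, Finset.filter_false, Finset.sum_empty, ENNReal.zero_rpow_of_pos ht0]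
  rw [(tendsto_const_nhds.congr' h0.symm).liminf_eq]

/-- A neighbourhood of a limit atom, whose closure avoids the other limit atoms, carries the mass
of exactly one atom in the end. -/
theorem eventually_atoms_eq [OpensMeasurableSpace X]
    (hx : ∀ i, Tendsto (fun t => x t i) atTop (𝓝 (y i))) {i : ι}
    {G : Set X} (hG : IsOpen G) (hi : y i ∈ G) (hj : ∀ j, j ≠ i → y j ∉ closure G) :
    ∀ᶠ t in atTop, atoms (w t) (x t) G = w t i := by
  classical
  have h1 : ∀ᶠ t in atTop, ∀ j, j ≠ i → x t j ∉ G := by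
    rw [eventually_all]
    intro j
    by_cases hji : j = i
    · simp [hji]
    · filter_upwards [(hx j).eventually
        (isClosed_closure.isOpen_compl.mem_nhds (hj j hji))] with t ht _ hc
      exact ht (subset_closure hc)
  filter_upwards [h1, (hx i).eventually (hG.mem_nhds hi)] with t ht hti
  rw [atoms_apply _ _ hG.measurableSet]
  have : ({j | x t j ∈ G} : Finset ι) = {i} := by
    ext j
    simp only [Finset.mem_filter, Finset.mem_univ, true_and, Finset.mem_singleton]
    exact ⟨fun h => by_contra fun hc => ht j hc h, fun h => h ▸ hti⟩
  rw [this, Finset.sum_singleton]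

/-- On a small neighbourhood G of `y i` the measure is eventually the single weight `w t i`. The
lower bound on G and the upper bound on its closure squeeze the root, since e^(-J) is upper
semicontinuous and so barely exceeds its value at `y i` there. -/
theorem LDP.tendsto_of_tendsto [RegularSpace X] [T1Space X] [OpensMeasurableSpace X]
    (h : LDP (fun t => atoms (w t) (x t)) J)
    (hx : ∀ i, Tendsto (fun t => x t i) atTop (𝓝 (y i))) (hy : Function.Injective y) (i : ι) :
    Tendsto (fun t => w t i ^ (1 / (t : ℝ))) atTop (𝓝 (EReal.exp (-(J (y i) : EReal)))) := by
  have key : ∀ U ∈ 𝓝 (y i), ∃ G : Set X, IsOpen G ∧ y i ∈ G ∧ closure G ⊆ U ∧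
      (fun t : ℝ≥0 => (atoms (w t) (x t) G) ^ (1 / (t : ℝ))) =ᶠ[atTop]
        fun t => w t i ^ (1 / (t : ℝ)) := by
    intro U hU
    obtain ⟨G, hG, hiG, hGU, hGy⟩ := exists_open_separating y (y i) hU
    refine ⟨G, hG, hiG, hGU, ?_⟩
    filter_upwards [eventually_atoms_eq (w := w) hx hG hiG
      fun j hj => hGy j (hy.ne hj)] with t ht
    rw [ht]
  refine tendsto_of_le_liminf_of_limsup_le ?_ ?_
  · obtain ⟨G, hG, hiG, -, he⟩ := key _ univ_mem
    rw [← liminf_congr he]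
    exact (le_iSup₂_of_le (y i) hiG le_rfl).trans (h.lower G hG)
  · refine le_of_forall_gt fun b hb => ?_
    obtain ⟨b', hb', hbb⟩ := exists_between hb
    have hU : {z | EReal.exp (-(J z : EReal)) < b'} ∈ 𝓝 (y i) :=
      exp_neg_upperSemicontinuous h.lsc (y i) b' hb'
    obtain ⟨G, hG, hiG, hGU, he⟩ := key _ hU
    rw [← limsup_congr he]
    refine lt_of_le_of_lt ?_ hbb
    calc _ ≤ limsup (fun t : ℝ≥0 => (atoms (w t) (x t) (closure G)) ^ (1 / (t : ℝ))) atTop := by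
          refine limsup_le_limsup ?_
          filter_upwards [eventually_one_div_pos] with t ht
          exact ENNReal.rpow_le_rpow (measure_mono subset_closure) ht.le
      _ ≤ _ := h.upper _ isClosed_closure
      _ ≤ b' := iSup₂_le fun z hz => (hGU hz).le

end Abstract

/-! ### Relabelling atoms whose rates, but not positions, are known -/

section Relabelling

variable {X ι : Type*} [TopologicalSpace X] [MeasurableSpace X] [Fintype ι]
variable {w : ℝ≥0 → ι → ℝ≥0∞} {x : ℝ≥0 → ι → X} {y : ι → X} {L : ι → ℝ≥0∞} {J : X → ℝ≥0∞}

/-- Under an LDP, each limit atom `y i` with `L i ≠ 0` attracts an atom of the same rate. -/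
theorem LDP.eventually_exists_mem [RegularSpace X] [T1Space X] [OpensMeasurableSpace X]
    (h : LDP (fun t => atoms (w t) (x t)) J)
    (hw : ∀ i, Tendsto (fun t => w t i ^ (1 / (t : ℝ))) atTop (𝓝 (L i)))
    (hJ : ∀ i, EReal.exp (-(J (y i) : EReal)) = L i) (hJ' : ∀ z, (∀ i, z ≠ y i) → J z = ⊤)
    {i : ι} (hi : L i ≠ 0) {U : Set X} (hU : U ∈ 𝓝 (y i)) :
    ∀ᶠ t in atTop, ∃ k, L k = L i ∧ x t k ∈ U := by
  classical
  obtain ⟨G, hG, hiG, hGU, hGy⟩ := exists_open_separating y (y i) hU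
  have hup : limsup (fun t : ℝ≥0 => (atoms (w t) (x t) (closure G)) ^ (1 / (t : ℝ))) atTop
      ≤ L i := by
    refine (h.upper _ isClosed_closure).trans (iSup₂_le fun z hz => ?_)
    by_cases hzy : ∃ j, z = y j
    · obtain ⟨j, rfl⟩ := hzy
      by_cases hji : y j = y i
      · rw [hji, hJ]
      · exact absurd hz (hGy j hji)
    · push Not at hzy
      rw [exp_neg_eq_zero_iff.2 (hJ' z hzy)]
      exact zero_le
  have hlow : L i ≤ liminf (fun t : ℝ≥0 => (atoms (w t) (x t) G) ^ (1 / (t : ℝ))) atTop := by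
    rw [← hJ i]
    exact (le_iSup₂_of_le (y i) hiG le_rfl).trans (h.lower G hG)
  -- heavier atoms stay away from `y i`
  have hheavy : ∀ᶠ t in atTop, ∀ k, L i < L k → x t k ∉ G := by
    rw [eventually_all]
    intro k
    by_cases hk : L i < L k
    swap
    · simp [hk]
    obtain ⟨b, hib, hbk⟩ := exists_between hk
    filter_upwards [(hw k).eventually (lt_mem_nhds hbk),
      eventually_lt_of_limsup_lt (hup.trans_lt hib), eventually_one_div_pos] with t h1 h2 h3 _ hkG
    exact (h1.trans_le (ENNReal.rpow_le_rpow
      (le_atoms _ _ isClosed_closure.measurableSet (subset_closure hkG)) h3.le)).not_gt h2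
  -- All lighter atoms together still have rate below `L i`, too little for the lower bound on G. If
  -- there are none, the supremum is 0, which is where `L i ≠ 0` enters.
  have hlight : (Finset.univ.filter fun k => L k < L i).sup L < L i :=
    (Finset.sup_lt_iff (pos_iff_ne_zero.2 hi)).2 fun k hk => (Finset.mem_filter.1 hk).2
  obtain ⟨b, hb1, hb2⟩ := exists_between hlight
  filter_upwards [hheavy, eventually_one_div_pos,
    eventually_lt_of_limsup_lt ((limsup_sum_rpow_le _ fun k _ => hw k).trans_lt hb1),
    eventually_lt_of_lt_liminf (hb2.trans_le hlow)] with t h1 h2 h3 h4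
  by_contra! hc
  refine (h4.trans_le (ENNReal.rpow_le_rpow (atoms_le _ _ hG.measurableSet
    fun k hk => ?_) h2.le)).not_gt h3
  rw [Finset.mem_filter]
  refine ⟨Finset.mem_univ _, lt_of_le_of_ne (not_lt.1 fun h => h1 k h hk) fun h => ?_⟩
  exact hc k h (hGU (subset_closure hk))

/-- For large t each `y i` with `L i ≠ 0` has an atom of its own rate in its private neighbourhood;
counting within a rate class shows that there is only one, and it must follow `y i` into every
smaller neighbourhood. -/
theorem LDP.exists_relabelling [RegularSpace X] [T2Space X] [OpensMeasurableSpace X]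
    (h : LDP (fun t => atoms (w t) (x t)) J) (hy : Function.Injective y)
    (hw : ∀ i, Tendsto (fun t => w t i ^ (1 / (t : ℝ))) atTop (𝓝 (L i)))
    (hJ : ∀ i, EReal.exp (-(J (y i) : EReal)) = L i) (hJ' : ∀ z, (∀ i, z ≠ y i) → J z = ⊤) :
    ∃ σ : ℝ≥0 → Equiv.Perm ι, (∀ t i, L (σ t i) = L i) ∧
      ∀ i, L i ≠ 0 → Tendsto (fun t => x t (σ t i)) atTop (𝓝 (y i)) := by
  classical
  obtain ⟨V, hV, hVd⟩ := (Set.finite_range y).t2_separation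
  have hdisj : ∀ {i j z}, z ∈ V (y i) → z ∈ V (y j) → i = j := by
    intro i j z hi hj
    by_contra hij
    exact Set.disjoint_left.1 (hVd ⟨i, rfl⟩ ⟨j, rfl⟩ (hy.ne hij)) hi hj
  have hex : ∀ t, ∃ σ : Equiv.Perm ι, (∀ i, L (σ i) = L i) ∧
      ((∀ i, L i ≠ 0 → ∃ k, L k = L i ∧ x t k ∈ V (y i)) →
        ∀ i, L i ≠ 0 → x t (σ i) ∈ V (y i)) := by
    intro t
    by_cases hg : ∀ i, L i ≠ 0 → ∃ k, L k = L i ∧ x t k ∈ V (y i)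
    swap
    · exact ⟨1, fun _ => rfl, fun hc => absurd hc hg⟩
    -- Indices of rate 0 are fixed. Since the choice preserves rates, they cannot collide with the
    -- others.
    have hg' : ∀ i, ∃ k, L k = L i ∧ (L i ≠ 0 → x t k ∈ V (y i)) ∧ (L i = 0 → k = i) := by
      intro i
      by_cases hi : L i = 0
      · exact ⟨i, rfl, fun hc => absurd hi hc, fun _ => rfl⟩
      · obtain ⟨k, hk, hkV⟩ := hg i hi
        exact ⟨k, hk, fun _ => hkV, fun hc => absurd hc hi⟩
    choose f hfL hfV hf0 using hg'
    have hinj : Function.Injective f := by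
      intro i j hij
      have hL : L i = L j := by rw [← hfL i, ← hfL j, hij]
      by_cases hi : L i = 0
      · rw [← hf0 i hi, ← hf0 j (hL ▸ hi), hij]
      · exact hdisj (hfV i hi) (hij ▸ hfV j (hL ▸ hi))
    exact ⟨Equiv.ofBijective f (Finite.injective_iff_bijective.1 hinj), hfL, fun _ => hfV⟩
  choose σ hσL hσV using hex
  refine ⟨σ, hσL, fun i hi => ?_⟩
  have hgood : ∀ᶠ t in atTop, ∀ i, L i ≠ 0 → ∃ k, L k = L i ∧ x t k ∈ V (y i) := by
    rw [eventually_all]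
    intro j
    by_cases hj : L j = 0
    · simp [hj]
    · filter_upwards [h.eventually_exists_mem hw hJ hJ' hj
        ((hV (y j)).2.mem_nhds (hV (y j)).1)] with t ht _ using ht
  intro U hU
  rw [mem_map]
  filter_upwards [hgood, h.eventually_exists_mem hw hJ hJ' hi
    (inter_mem hU ((hV (y i)).2.mem_nhds (hV (y i)).1))] with t ht htk
  obtain ⟨k, hk, hkU, hkV⟩ := htk
  -- By surjectivity the atom found in U is already assigned to some `j` of the same nonzero rate;
  -- it lies in both `V (y j)` and `V (y i)`, so `j = i`.
  obtain ⟨j, rfl⟩ := (σ t).surjective k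
  have hj : L j ≠ 0 := by rwa [← hσL t j, hk]
  obtain rfl : j = i := hdisj (hσV t ht j hj) hkV
  exact hkU

end Relabelling

/-! ### Spectra and diagonal forms -/

section Spectra

theorem eq_of_antitone_of_map_eq {N : ℕ} {a b : Fin N → ℝ} (ha : Antitone a) (hb : Antitone b)
    (h : Finset.univ.val.map a = Finset.univ.val.map b) : a = b := by
  rw [Fin.univ_val_map, Fin.univ_val_map, Multiset.coe_eq_coe] at h
  exact List.ofFn_injective (List.Perm.eq_of_pairwise (fun _ _ _ _ h1 h2 => le_antisymm h2 h1)
    ha.sortedGE_ofFn.pairwise hb.sortedGE_ofFn.pairwise h)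

theorem exists_perm_of_map_eq {N : ℕ} {a b : Fin N → ℝ} (ha : Antitone a)
    (h : Finset.univ.val.map a = Finset.univ.val.map b) : ∃ τ : Equiv.Perm (Fin N), a = b ∘ τ := by
  -- Sorting in the order dual gives the nonincreasing order.
  set τ := Tuple.sort (OrderDual.toDual ∘ b)
  refine ⟨τ, eq_of_antitone_of_map_eq ha (b := b ∘ τ) ?_ ?_⟩
  · exact fun i j hij => Tuple.monotone_sort (OrderDual.toDual ∘ b) hij
  · rw [h, ← Multiset.map_map]
    congr 1
    exact (Multiset.map_univ_val_equiv τ).symm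

theorem map_ofReal_injective {N : ℕ} {a b : Fin N → ℝ}
    (h : (Finset.univ.val.map fun i => (a i : ℂ)) = Finset.univ.val.map fun i => (b i : ℂ)) :
    Finset.univ.val.map a = Finset.univ.val.map b := by
  have h1 := congrArg (Multiset.map Complex.re) h
  simpa [Multiset.map_map, Function.comp_def] using h1

theorem IsOrderedSpectrum.charpoly_eq {N : ℕ} {ρ : Matrix (Fin N) (Fin N) ℂ} {a : Fin N → ℝ}
    (h : IsOrderedSpectrum ρ a) :
    ρ.charpoly = ∏ i, (Polynomial.X - Polynomial.C (a i : ℂ)) := by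
  rw [(IsAlgClosed.splits ρ.charpoly).eq_prod_roots_of_monic ρ.charpoly_monic, h.2,
    Multiset.map_map]
  rfl

theorem IsOrderedSpectrum.mem_Icc {N : ℕ} {ρ : Matrix (Fin N) (Fin N) ℂ} {a : Fin N → ℝ}
    (h : IsOrderedSpectrum ρ a) (hρ : IsDensity ρ) (i : Fin N) : a i ∈ Set.Icc (0 : ℝ) 1 := by
  have h0 : ∀ i, 0 ≤ a i := by
    intro i
    have hi : (a i : ℂ) ∈ ρ.charpoly.roots := by
      rw [h.2]
      exact Multiset.mem_map_of_mem (fun i => (a i : ℂ)) (Finset.mem_univ_val i)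
    rw [hρ.1.1.roots_charpoly_eq_eigenvalues, Multiset.mem_map] at hi
    obtain ⟨j, -, hj⟩ := hi
    have hj' : hρ.1.1.eigenvalues j = a i := Complex.ofReal_injective hj
    exact hj' ▸ hρ.1.eigenvalues_nonneg j
  have hsum : ∑ i, a i = 1 := by
    have h1 := hρ.2
    rw [trace_eq_sum_roots_charpoly, h.2] at h1
    have h2 : ((∑ i, a i : ℝ) : ℂ) = 1 := by
      rw [Complex.ofReal_sum]
      exact h1
    exact_mod_cast h2
  exact ⟨h0 i, hsum ▸ Finset.single_le_sum (f := a) (fun j _ => h0 j) (Finset.mem_univ i)⟩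

/-- Evaluation at matrix units reads off the entries. -/
theorem tendsto_of_tendsto_omega {N : ℕ} {α : Type*} {l : Filter α}
    {A : α → Matrix (Fin N) (Fin N) ℂ} {B : Matrix (Fin N) (Fin N) ℂ}
    (h : Tendsto (fun t => omega (A t)) l (𝓝 (omega B))) : Tendsto A l (𝓝 B) := by
  refine tendsto_pi_nhds.2 fun i => tendsto_pi_nhds.2 fun j => ?_
  have h1 := ((WeakDual.eval_continuous (Matrix.single j i (1 : ℂ))).tendsto _).comp h
  simpa [Function.comp_def, trace_mul_single] using h1

/-- Ordered eigenvalues of density matrices depend continuously on the matrix. -/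
theorem tendsto_orderedSpectrum {N : ℕ} {α : Type*} {l : Filter α}
    {ρ : α → Matrix (Fin N) (Fin N) ℂ} {ρinf : Matrix (Fin N) (Fin N) ℂ}
    (hρ : ∀ t, IsDensity (ρ t)) (hconv : Tendsto ρ l (𝓝 ρinf))
    {a : α → Fin N → ℝ} {ainf : Fin N → ℝ} (ha : ∀ t, IsOrderedSpectrum (ρ t) (a t))
    (hainf : IsOrderedSpectrum ρinf ainf) : Tendsto a l (𝓝 ainf) := by
  -- The eigenvalue lists stay in the compact cube [0,1]^N, so along each ultrafilter they have a
  -- limit. It is again nonincreasing, and continuity of the characteristic polynomial makes its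
  -- entries the roots for `ρinf`, so it is `ainf`.
  rw [tendsto_iff_ultrafilter]
  intro u hu
  have hmem : ∀ t, a t ∈ Set.univ.pi fun _ : Fin N => Set.Icc (0 : ℝ) 1 :=
    fun t i _ => (ha t).mem_Icc (hρ t) i
  obtain ⟨α', -, hα⟩ := (isCompact_univ_pi fun _ : Fin N => isCompact_Icc (a := (0 : ℝ))
    (b := 1)).ultrafilter_le_nhds (u.map a) (by
      rw [le_principal_iff]
      exact Filter.mem_map.2 (univ_mem' hmem))
  have hα' : Tendsto a u (𝓝 α') := hα
  have hαi : ∀ i, Tendsto (fun t => a t i) u (𝓝 (α' i)) := tendsto_pi_nhds.1 hα'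
  have hanti : Antitone α' := fun i j hij =>
    le_of_tendsto_of_tendsto' (hαi j) (hαi i) fun t => (ha t).1 hij
  have hpoly : ρinf.charpoly = ∏ i, (Polynomial.X - Polynomial.C (α' i : ℂ)) := by
    refine Polynomial.funext fun z => ?_
    have h1 : Tendsto (fun t => (ρ t).charpoly.eval z) u (𝓝 (ρinf.charpoly.eval z)) := by
      simp only [eval_charpoly]
      exact ((continuous_const.sub continuous_id).matrix_det.tendsto _).comp (hconv.mono_left hu)
    refine tendsto_nhds_unique h1 ?_
    simp only [(ha _).charpoly_eq, Polynomial.eval_prod, Polynomial.eval_sub, Polynomial.eval_X,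
      Polynomial.eval_C]
    exact tendsto_finsetProd _ fun i _ => tendsto_const_nhds.sub
      ((Complex.continuous_ofReal.tendsto _).comp (hαi i))
  have hroots : ρinf.charpoly.roots = Finset.univ.val.map fun i => (α' i : ℂ) := by
    rw [hpoly, Polynomial.roots_prod _ _
      (Finset.prod_ne_zero_iff.2 fun i _ => Polynomial.X_sub_C_ne_zero _)]
    simp
  rw [eq_of_antitone_of_map_eq hainf.1 hanti (map_ofReal_injective (hainf.2.symm.trans hroots))]
  exact hα'

theorem dotProduct_star_basis {N : ℕ}
    (f : OrthonormalBasis (Fin N) ℂ (EuclideanSpace ℂ (Fin N))) (i j : Fin N) :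
    star (f i).ofLp ⬝ᵥ (f j).ofLp = if i = j then 1 else 0 := by
  rw [dotProduct_comm, ← EuclideanSpace.inner_eq_star_dotProduct]
  exact orthonormal_iff_ite.1 f.orthonormal i j

theorem IsDiagonalForm.mulVec {N : ℕ} {ρ : Matrix (Fin N) (Fin N) ℂ} {b : Fin N → ℝ}
    {f : OrthonormalBasis (Fin N) ℂ (EuclideanSpace ℂ (Fin N))} (h : IsDiagonalForm ρ b f)
    (k : Fin N) : ρ *ᵥ (f k).ofLp = (b k : ℂ) • (f k).ofLp := by
  rw [h, sum_mulVec, Finset.sum_eq_single k]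
  · rw [smul_mulVec, ketBra, vecMulVec_mulVec, dotProduct_star_basis]
    simp
  · intro j _ hj
    rw [smul_mulVec, ketBra, vecMulVec_mulVec, dotProduct_star_basis, if_neg hj]
    simp
  · simp

theorem IsDiagonalForm.roots_charpoly {N : ℕ} {ρ : Matrix (Fin N) (Fin N) ℂ} {b : Fin N → ℝ}
    {f : OrthonormalBasis (Fin N) ℂ (EuclideanSpace ℂ (Fin N))} (h : IsDiagonalForm ρ b f) :
    ρ.charpoly.roots = Finset.univ.val.map fun i => (b i : ℂ) := by
  let U : Matrix (Fin N) (Fin N) ℂ := Matrix.of fun i k => f k i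
  have hU : Uᴴ * U = 1 := by
    ext i j
    rw [one_apply, ← dotProduct_star_basis f i j]
    rfl
  have hρ : ρ = U * diagonal (fun i => (b i : ℂ)) * Uᴴ := by
    ext i j
    rw [h, Matrix.sum_apply, Matrix.mul_apply]
    refine Finset.sum_congr rfl fun k _ => ?_
    simp only [mul_diagonal, Matrix.smul_apply, ketBra, vecMulVec_apply, conjTranspose_apply, U,
      Matrix.of_apply, smul_eq_mul, Pi.star_apply]
    ring
  rw [hρ, charpoly_mul_comm, ← mul_assoc, hU, one_mul, charpoly_diagonal, Polynomial.roots_prod _ _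
    (Finset.prod_ne_zero_iff.2 fun i _ => Polynomial.X_sub_C_ne_zero _)]
  simp

/-- Expresses an eigenvalue continuously in the matrix and the projection. -/
theorem trace_mul_ketBra_of_eigen {N : ℕ} {ρ : Matrix (Fin N) (Fin N) ℂ}
    {v : EuclideanSpace ℂ (Fin N)} (hv : ‖v‖ = 1) {c : ℂ} (h : ρ *ᵥ v.ofLp = c • v.ofLp) :
    (ρ * ketBra v).trace = c := by
  rw [ketBra, mul_vecMulVec, h, trace_vecMulVec, smul_dotProduct, dotProduct_comm,
    dotProduct_of_norm_one hv, smul_eq_mul, mul_one]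

theorem basisState_injective {N : ℕ}
    (f : OrthonormalBasis (Fin N) ℂ (EuclideanSpace ℂ (Fin N))) :
    Function.Injective (basisState f) := by
  intro i j hij
  by_contra hne
  have h1 : omega (ketBra (f i)) = omega (ketBra (f j)) := congrArg Subtype.val hij
  have h2 := DFunLike.congr_fun h1 (ketBra (f i))
  rw [omega_apply, omega_apply, ketBra_mul_self (f.orthonormal.1 i)] at h2
  simp only [ketBra, vecMulVec_mul_vecMulVec, trace_vecMulVec,
    dotProduct_star_basis, vecMulVec_smul] at h2
  rw [trace_smul, dotProduct_comm, dotProduct_star_basis, if_neg (Ne.symm hne)] at h2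
  simp at h2

instance (N : ℕ) : T3Space (PureState N) :=
  inferInstanceAs (T3Space ↥(Set.extremePoints ℝ (stateSpace N)))

/-- The projections converge, though phases may keep the vectors from converging. The index varies
with t because the relabelling does. -/
theorem tendsto_ketBra {N : ℕ} {α : Type*} {l : Filter α}
    {e : α → OrthonormalBasis (Fin N) ℂ (EuclideanSpace ℂ (Fin N))}
    {einf : OrthonormalBasis (Fin N) ℂ (EuclideanSpace ℂ (Fin N))} {k : α → Fin N} {i : Fin N}
    (h : Tendsto (fun t => basisState (e t) (k t)) l (𝓝 (basisState einf i))) :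
    Tendsto (fun t => ketBra (e t (k t))) l (𝓝 (ketBra (einf i))) :=
  tendsto_of_tendsto_omega ((continuous_subtype_val.tendsto _).comp h)

end Spectra

/-! ### The rate function -/

section RateFunction

theorem tendsto_rpow_one_div_of_pos {u : ℝ≥0 → ℝ} {m : ℝ} (hu : Tendsto u atTop (𝓝 m))
    (hm : 0 < m) :
    Tendsto (fun t : ℝ≥0 => ENNReal.ofReal (u t) ^ (1 / (t : ℝ))) atTop (𝓝 1) := by
  have h1 : Tendsto (fun t => (u t).toNNReal) atTop (𝓝 m.toNNReal) :=
    (continuous_real_toNNReal.tendsto m).comp hu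
  have hm' : m.toNNReal ≠ 0 := by simpa using hm
  have h2 := h1.nnrpow tendsto_one_div_atTop (Or.inl hm')
  rw [NNReal.rpow_zero] at h2
  refine (ENNReal.tendsto_coe.2 h2).congr' ?_
  filter_upwards [h1.eventually_ne hm'] with t ht
  exact ENNReal.coe_rpow_of_ne_zero ht _

theorem logRate_eq_log_rpow (t : ℝ≥0) (m : ℝ≥0∞) :
    logRate t m = ENNReal.log (m ^ (1 / (t : ℝ))) := by
  rw [ENNReal.log_rpow, logRate]

/-- `exp` and `log` are mutually inverse and continuous between [-∞,∞] and [0,∞], so zero weights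
need no separate case. -/
theorem tendsto_logRate_iff {m : ℝ≥0 → ℝ≥0∞} {l : EReal} :
    Tendsto (fun t => logRate t (m t)) atTop (𝓝 l) ↔
      Tendsto (fun t => m t ^ (1 / (t : ℝ))) atTop (𝓝 (EReal.exp l)) := by
  simp only [logRate_eq_log_rpow]
  constructor
  · intro h
    simpa [Function.comp_def] using (ENNReal.continuous_exp.tendsto _).comp h
  · intro h
    simpa [Function.comp_def] using (ENNReal.continuous_log.tendsto _).comp h

theorem nonpos_of_tendsto_logRate {m : ℝ≥0 → ℝ≥0∞} (hm : ∀ t, m t ≤ 1) {l : EReal}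
    (h : Tendsto (fun t => logRate t (m t)) atTop (𝓝 l)) : l ≤ 0 := by
  refine le_of_tendsto' h fun t => ?_
  rw [logRate_eq_log_rpow, ← ENNReal.log_one]
  exact ENNReal.log_monotone (ENNReal.rpow_le_one (hm t) (by positivity))

variable {N : ℕ} (e : OrthonormalBasis (Fin N) ℂ (EuclideanSpace ℂ (Fin N))) (r : ℕ)
  (c : Fin N → EReal)

/-- The limit of `a_{i,t} ^ (1 / t)` if `c_i = lim (1/t) log a_{i,t}` for `r ≤ i`. -/
def limRoot (i : Fin N) : ℝ≥0∞ := if (i : ℕ) < r then 1 else EReal.exp (c i)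

theorem rateFn_eq_top {z : PureState N} (hz : ∀ i, z ≠ basisState e i) : rateFn e r c z = ⊤ := by
  simp [rateFn, hz]

/-- The sign condition on `c` ensures that `toENNReal` truncates nothing. -/
theorem exp_neg_rateFn (hc : ∀ i : Fin N, r ≤ (i : ℕ) → c i ≤ 0) (i : Fin N) :
    EReal.exp (-(rateFn e r c (basisState e i) : EReal)) = limRoot r c i := by
  have hinj : ∀ j, basisState e i = basisState e j ↔ j = i :=
    fun j => (basisState_injective e).eq_iff.trans eq_comm
  by_cases hi : (i : ℕ) < r
  · simp [rateFn, limRoot, hinj, hi]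
  · have hi' : r ≤ (i : ℕ) := not_lt.1 hi
    have h1 : rateFn e r c (basisState e i) = (-(c i)).toENNReal := by
      have hn : ¬ ∃ j : Fin N, (j : ℕ) < r ∧ basisState e i = basisState e j := by
        rintro ⟨j, hj, hij⟩
        exact hi ((hinj j).1 hij ▸ hj)
      rw [rateFn, if_neg hn]
      refine le_antisymm (iInf₂_le i ⟨hi', rfl⟩) (le_iInf₂ fun j hj => ?_)
      rw [(hinj j).1 hj.2]
    rw [h1, EReal.coe_toENNReal (EReal.neg_nonneg.2 (hc i hi')), neg_neg, limRoot, if_neg hi]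

theorem rateFn_unique {J : PureState N → ℝ≥0∞} (hc : ∀ i : Fin N, r ≤ (i : ℕ) → c i ≤ 0)
    (h1 : ∀ i, EReal.exp (-(J (basisState e i) : EReal)) = limRoot r c i)
    (h2 : ∀ z, (∀ i, z ≠ basisState e i) → J z = ⊤) : J = rateFn e r c := by
  funext z
  by_cases hz : ∃ i, z = basisState e i
  · obtain ⟨i, rfl⟩ := hz
    exact exp_neg_injective ((h1 i).trans (exp_neg_rateFn e r c hc i).symm)
  · push Not at hz
    rw [h2 z hz, rateFn_eq_top e r c hz]

end RateFunction

end OrthLDP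

end

/-! ### Orthogonal measures of converging density matrices -/

theorem mainTheorem5 {N : ℕ}
    -- states `ω_{ρ_t}` converging to the state `ω_{ρ_∞}`
    (ρ : ℝ≥0 → Matrix (Fin N) (Fin N) ℂ) (ρinf : Matrix (Fin N) (Fin N) ℂ)
    (hρ : ∀ t, OrthLDP.IsDensity (ρ t)) (hρinf : OrthLDP.IsDensity ρinf)
    (hconv : Tendsto (fun t => OrthLDP.omega (ρ t)) atTop (𝓝 (OrthLDP.omega ρinf)))
    -- ordered eigenvalues; the first `r` eigenvalues of `ρ_∞` are the non-zero ones
    (a : ℝ≥0 → Fin N → ℝ) (ainf : Fin N → ℝ) (r : ℕ)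
    (ha : ∀ t, OrthLDP.IsOrderedSpectrum (ρ t) (a t))
    (hainf : OrthLDP.IsOrderedSpectrum ρinf ainf)
    (hr : ∀ i : Fin N, ainf i ≠ 0 ↔ (i : ℕ) < r) :
    -- (a)
    (∀ (e : ℝ≥0 → OrthonormalBasis (Fin N) ℂ (EuclideanSpace ℂ (Fin N)))
        (einf : OrthonormalBasis (Fin N) ℂ (EuclideanSpace ℂ (Fin N))),
      (∀ i, OrthLDP.EigenvectorConv ρ ρinf a ainf e einf i) →
      ((∃ J, OrthLDP.LDP (fun t => OrthLDP.orthMeasure (a t) (e t)) J) ↔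
        ∀ i : Fin N, r ≤ (i : ℕ) → ∃ l : EReal,
          Tendsto (fun t => OrthLDP.logRate t (ENNReal.ofReal (a t i))) atTop (𝓝 l)) ∧
      (∀ c : Fin N → EReal,
        (∀ i : Fin N, r ≤ (i : ℕ) →
          Tendsto (fun t => OrthLDP.logRate t (ENNReal.ofReal (a t i))) atTop (𝓝 (c i))) →
        (∀ J, OrthLDP.LDP (fun t => OrthLDP.orthMeasure (a t) (e t)) J ↔
          J = OrthLDP.rateFn einf r c) ∧
        (∀ (i : Fin N) (G : Set (OrthLDP.PureState N)), IsOpen G →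
          OrthLDP.basisState einf i ∈ G →
          (∀ j, j ≠ i → OrthLDP.basisState einf j ∉ closure G) →
          ∃ l : EReal,
            Tendsto (fun t => OrthLDP.logRate t (OrthLDP.orthMeasure (a t) (e t) G))
              atTop (𝓝 l) ∧
            Tendsto (fun t => OrthLDP.logRate t (ENNReal.ofReal (a t i))) atTop (𝓝 l)))) ∧
    -- (b)
    (∀ (einf : OrthonormalBasis (Fin N) ℂ (EuclideanSpace ℂ (Fin N)))
        (μ : ℝ≥0 → Measure (OrthLDP.PureState N)) (c : Fin N → EReal),
      OrthLDP.IsDiagonalForm ρinf ainf einf →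
      (∀ t, OrthLDP.IsOrthogonalMeasure (ρ t) (μ t)) →
      (∀ i : Fin N, r ≤ (i : ℕ) →
        Tendsto (fun t => OrthLDP.logRate t (ENNReal.ofReal (a t i))) atTop (𝓝 (c i))) →
      OrthLDP.LDP μ (OrthLDP.rateFn einf r c) →
      -- relabelling by permutations that only exchange indices with the same limits
      ∃ (σ : ℝ≥0 → Equiv.Perm (Fin N))
        (e : ℝ≥0 → OrthonormalBasis (Fin N) ℂ (EuclideanSpace ℂ (Fin N))),
        ∀ i : Fin N, OrthLDP.rateFn einf r c (OrthLDP.basisState einf i) < ⊤ →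
          OrthLDP.EigenvectorConv ρ ρinf (fun t k => a t (σ t k)) ainf e einf i ∧
          ∀ᶠ t in atTop, ainf (σ t i) = ainf i ∧
            OrthLDP.rateFn einf r c (OrthLDP.basisState einf (σ t i)) =
              OrthLDP.rateFn einf r c (OrthLDP.basisState einf i)) := by
  have hρc : Tendsto ρ atTop (𝓝 ρinf) := OrthLDP.tendsto_of_tendsto_omega hconv
  have hac : ∀ i, Tendsto (fun t => a t i) atTop (𝓝 (ainf i)) :=
    tendsto_pi_nhds.1 (OrthLDP.tendsto_orderedSpectrum hρ hρc ha hainf)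
  have ha1 : ∀ i t, ENNReal.ofReal (a t i) ≤ 1 := fun i t =>
    ENNReal.ofReal_le_one.2 ((ha t).mem_Icc (hρ t) i).2
  have hcn : ∀ {c : Fin N → EReal}, (∀ i : Fin N, r ≤ (i : ℕ) →
      Tendsto (fun t => OrthLDP.logRate t (ENNReal.ofReal (a t i))) atTop (𝓝 (c i))) →
      ∀ i : Fin N, r ≤ (i : ℕ) → c i ≤ 0 :=
    fun hc i hi => OrthLDP.nonpos_of_tendsto_logRate (ha1 i) (hc i hi)
  have hroot : ∀ {c : Fin N → EReal}, (∀ i : Fin N, r ≤ (i : ℕ) →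
      Tendsto (fun t => OrthLDP.logRate t (ENNReal.ofReal (a t i))) atTop (𝓝 (c i))) →
      ∀ i, Tendsto (fun t : ℝ≥0 => ENNReal.ofReal (a t i) ^ (1 / (t : ℝ))) atTop
        (𝓝 (OrthLDP.limRoot r c i)) := by
    intro c hc i
    by_cases hi : (i : ℕ) < r
    · rw [OrthLDP.limRoot, if_pos hi]
      exact OrthLDP.tendsto_rpow_one_div_of_pos (hac i)
        (lt_of_le_of_ne (hainf.mem_Icc hρinf i).1 ((hr i).2 hi).symm)
    · rw [OrthLDP.limRoot, if_neg hi]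
      exact OrthLDP.tendsto_logRate_iff.1 (hc i (not_lt.1 hi))
  refine ⟨fun e einf hP => ?_, fun einf μ c hdiag hμ hc hLDP => ?_⟩
  · have hx : ∀ i, Tendsto (fun t => OrthLDP.basisState (e t) i) atTop
        (𝓝 (OrthLDP.basisState einf i)) := fun i => (hP i).tendsto
    have hinj := OrthLDP.basisState_injective einf
    have hldp : ∀ {c : Fin N → EReal}, (∀ i : Fin N, r ≤ (i : ℕ) →
        Tendsto (fun t => OrthLDP.logRate t (ENNReal.ofReal (a t i))) atTop (𝓝 (c i))) →
        OrthLDP.LDP (fun t => OrthLDP.orthMeasure (a t) (e t)) (OrthLDP.rateFn einf r c) :=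
      fun hc => OrthLDP.ldp_of_tendsto hx (hroot hc)
        (OrthLDP.exp_neg_rateFn einf r _ (hcn hc)) fun _ => OrthLDP.rateFn_eq_top einf r _
    refine ⟨⟨?_, ?_⟩, fun c hc => ⟨fun J => ⟨fun hJ => ?_, ?_⟩, fun i G hG hiG hjG => ?_⟩⟩
    · rintro ⟨J, hJ⟩ i -
      exact ⟨_, OrthLDP.tendsto_logRate_iff.2
        (OrthLDP.LDP.tendsto_of_tendsto hJ hx hinj i)⟩
    · intro hl
      have hl' : ∀ i : Fin N, ∃ l : EReal, r ≤ (i : ℕ) →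
          Tendsto (fun t => OrthLDP.logRate t (ENNReal.ofReal (a t i))) atTop (𝓝 l) := by
        intro i
        by_cases hi : r ≤ (i : ℕ)
        · exact (hl i hi).imp fun l hl _ => hl
        -- A dummy value: `rateFn` does not read `c` below `r`.
        · exact ⟨0, fun hc => absurd hc hi⟩
      choose c hc using hl'
      exact ⟨_, hldp hc⟩
    · refine OrthLDP.rateFn_unique einf r c (hcn hc) (fun i => ?_) fun z hz => ?_
      · exact tendsto_nhds_unique (OrthLDP.LDP.tendsto_of_tendsto hJ hx hinj i) (hroot hc i)
      · exact OrthLDP.LDP.eq_top_of_tendsto hJ hx hz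
    · rintro rfl
      exact hldp hc
    · have hlim : Tendsto (fun t => OrthLDP.logRate t (ENNReal.ofReal (a t i))) atTop
          (𝓝 (ENNReal.log (OrthLDP.limRoot r c i))) :=
        OrthLDP.tendsto_logRate_iff.2 (by simpa using hroot hc i)
      refine ⟨_, hlim.congr' ?_, hlim⟩
      filter_upwards [OrthLDP.eventually_atoms_eq (w := fun t i => ENNReal.ofReal (a t i))
        hx hG hiG hjG] with t ht
      rw [← ht]
      rfl
  · choose b f hbf hμb using hμ
    -- The weights of any diagonal form are the ordered eigenvalues permuted, so μ_t has weights `a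
    -- t i` after moving its atoms by `τ t`.
    have hperm : ∀ t, ∃ τ : Equiv.Perm (Fin N), a t = b t ∘ τ := fun t =>
      OrthLDP.exists_perm_of_map_eq (ha t).1
        (OrthLDP.map_ofReal_injective ((ha t).2.symm.trans (hbf t).roots_charpoly))
    choose τ hτ using hperm
    have hμ' : μ = fun t => OrthLDP.atoms (fun i => ENNReal.ofReal (a t i))
        (fun i => OrthLDP.basisState (f t) (τ t i)) := by
      funext t
      rw [hμb t, OrthLDP.orthMeasure, OrthLDP.atoms, hτ t]
      exact (Equiv.sum_comp (τ t) fun i =>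
        ENNReal.ofReal (b t i) • Measure.dirac (OrthLDP.basisState (f t) i)).symm
    rw [hμ'] at hLDP
    have hexp := OrthLDP.exp_neg_rateFn einf r c (hcn hc)
    obtain ⟨σ, hσL, hσ⟩ := hLDP.exists_relabelling (OrthLDP.basisState_injective einf)
      (hroot hc) hexp fun _ => OrthLDP.rateFn_eq_top einf r c
    have heig : ∀ t i, ρ t *ᵥ (f t (τ t i)).ofLp = (a t i : ℂ) • (f t (τ t i)).ofLp := by
      intro t i
      rw [(hbf t).mulVec, hτ t]
      rfl
    refine ⟨σ, fun t => (f t).reindex ((σ t).trans (τ t)).symm, fun i hi => ?_⟩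
    have hfi : ∀ t, (f t).reindex ((σ t).trans (τ t)).symm i = f t (τ t (σ t i)) := by
      intro t
      simp
    have hi0 : OrthLDP.limRoot r c i ≠ 0 := by
      rw [← hexp i]
      exact fun h0 => hi.ne (OrthLDP.exp_neg_eq_zero_iff.1 h0)
    have hti := hσ i hi0
    refine ⟨⟨Eventually.of_forall fun t => ?_, hdiag.mulVec i, ?_⟩, ?_⟩
    · rw [hfi]
      exact heig t (σ t i)
    · refine hti.congr fun t => ?_
      exact Subtype.ext (congrArg (fun v => OrthLDP.omega (OrthLDP.ketBra v)) (hfi t).symm)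
    -- The rate alone does not determine `ainf i`, since all indices below `r` share the root 1. The
    -- trace against the projection supplies the missing limit.
    · have h1 : Tendsto (fun t => (a t (σ t i) : ℂ)) atTop (𝓝 (ainf i : ℂ)) := by
        have h2 := ((continuous_fst.matrix_mul continuous_snd).matrix_trace.tendsto
          (ρinf, OrthLDP.ketBra (einf i))).comp (hρc.prodMk_nhds (OrthLDP.tendsto_ketBra hti))
        rw [OrthLDP.trace_mul_ketBra_of_eigen (einf.orthonormal.1 i) (hdiag.mulVec i)] at h2
        refine h2.congr fun t => ?_
        exact OrthLDP.trace_mul_ketBra_of_eigen ((f t).orthonormal.1 _) (heig t (σ t i))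
      have h2 : Tendsto (fun t => a t (σ t i)) atTop (𝓝 (ainf i)) :=
        (Complex.continuous_re.tendsto _).comp h1
      -- If `σ t i = k`, then `a t k` would be close to both `ainf k` and `ainf i`.
      have h3 : ∀ k, ainf k ≠ ainf i → ∀ᶠ t in atTop, σ t i ≠ k := by
        intro k hk
        obtain ⟨u, v, hu, hv, hku, hiv, huv⟩ := t2_separation hk
        filter_upwards [(hac k).eventually (hu.mem_nhds hku), h2.eventually (hv.mem_nhds hiv)]
          with t htk hti hc
        rw [hc] at hti
        exact Set.disjoint_left.1 huv htk hti
      have h4 : ∀ᶠ t in atTop, ∀ k, ainf k ≠ ainf i → σ t i ≠ k := by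
        rw [eventually_all]
        intro k
        by_cases hk : ainf k = ainf i
        · simp [hk]
        · simpa [hk] using h3 k hk
      filter_upwards [h4] with t ht
      refine ⟨by_contra fun hne => ht _ hne rfl, OrthLDP.exp_neg_injective ?_⟩
      exact (hexp _).trans ((hσL t i).trans (hexp i).symm)
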